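/- Let $C^0=C^0([-1,1])$ be the Banach space of real continuous functions on $[-1,1]$ with the uniform norm, and let $B(f,\rho)=\{u\in C^0:\|u-f\|_\infty\le\rho\}$. Let $k_1,k_2:[-1,1]^2\to\mathbb R$ be continuous kernels such that, for $i=1,2$, [K1] $\displaystyle \sup_{y\in[-1,1]}\int_{-1}^1|k_i(x,y)|\,dx<\infty$ and $\displaystyle \lim_{y\to\tilde y}\int_{-1}^1|k_i(x,y)-k_i(x,\tilde y)|\,dx=0$ for every $\tilde y\in[-1,1]$ (which for continuous kernels holds automatically). Let [H1] $h:[-1,1]\times\mathbb R\to\mathbb R$ be continuous, and [G1] $g:[-1,1]\to\mathbb R$ be continuous. Define $\mathcal G:C^0\to C^0$ by $$(\mathcal Gf)(y)=\int_{-1}^1k_1(x,y)f(x)\,dx+\int_{-1}^1k_2(x,y)h(x,f(x))\,dx+g(y).$$ For $m\ge1$ let $x_1,\dots,x_m$ be the zeros of the orthonormal Legendre polynomial $p_m$ of degree $m$ on $[-1,1]$, let $\lambda_k=\big(\sum_{i=0}^{m-1}p_i(x_k)^2\big)^{-1}$ be the Christoffel numbers (the weights of the $m$-point Gauss–Legendre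 rule), and define the discretised operator $\mathcal G_m:C^0\to C^0$ by $$(\mathcal G_mf)(y)=\sum_{k=1}^m\lambda_kk_1(x_k,y)f(x_k)+\sum_{k=1}^m\lambda_kk_2(x_k,y)h(x_k,f(x_k))+g(y).$$ Let $f^*\in C^0$ be a fixed point of $\mathcal G$ and let $\delta>0$. Assume that, on the set $T=\{(x,v):x\in[-1,1],\ |v-f^*(x)|\le\delta\}$ of the pairs $(x,f(x))$ with $f\in B(f^*,\delta)$, [H2] the partial derivative $h_v=\partial h/\partial v$ exists and is continuous on $T$, and [H3] the second partial derivative $h_{vv}=\partial^2h/\partial v^2$ exists and is continuous on $T$ (derivatives in $v$ being taken within the interval $[f^*(x)-\delta,f^*(x)+\delta]$, hence one-sided at its end points). Assume moreover that $1$ is not an eigenvalue of the linear operator $\mathcal G'(f^*):C^0\to C^0$, $$[\mathcal G'(f^*)\phi](y)=\int_{-1}^1k_1(x,y)\phi(x)\,dx+\int_{-1}^1k_2(x,y)h_v(x,f^*(x))\phi(x)\,dx.$$ Then there are $\varepsilon$ with $0<\varepsilon\le\delta$ and $m_0\in\mathbb N$ such that for every $m\ge m_0$ the operator $\mathcal G_m$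 has exactly one fixed point $f_m$ in $B(f^*,\varepsilon)$. -/

import Mathlib

open MeasureTheory Filter Topology Polynomial

noncomputable section

namespace Nystrom

/-- The interval `[-1, 1]`, with (the restriction of) Lebesgue measure as its volume. -/
abbrev I : Type := Set.Icc (-1 : ℝ) 1

instance : MeasureSpace I := Measure.Subtype.measureSpace

instance : IsFiniteMeasure (volume : Measure I) :=
  ⟨by
    rw [Measure.Subtype.volume_univ measurableSet_Icc.nullMeasurableSet]
    exact measure_Icc_lt_top⟩

/-- The Banach space `C⁰([-1, 1])` with the uniform norm. -/
abbrev C0 : Type := C(I, ℝ)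

/-! ### The Gauss-Legendre rule -/

/-- The orthonormal Legendre polynomial `p_m` of degree `m` on `[-1, 1]` (with positive leading
coefficient), through the formula of Rodrigues:
`p_m(x) = √((2m+1)/2) / (2^m m!) * (d/dx)^m (x^2 - 1)^m`. -/
def legendreOrtho (m : ℕ) : ℝ[X] :=
  C (Real.sqrt ((2 * m + 1) / 2) / (2 ^ m * (m.factorial : ℝ))) *
    derivative^[m] ((X ^ 2 - 1) ^ m)

open Classical in
/-- The Gauss-Legendre nodes `x_1, …, x_m`: the zeros of `p_m` (all of them lie in `[-1, 1]`). -/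
def nodes (m : ℕ) : Finset I :=
  (legendreOrtho m).roots.toFinset.subtype (fun x => x ∈ Set.Icc (-1 : ℝ) 1)

/-- The `m`-th Christoffel function `(∑_{i < m} p_i(x)^2)⁻¹`; its value at the node `x_k` is the
Christoffel number `λ_k`. -/
def christoffel (m : ℕ) (x : ℝ) : ℝ :=
  (∑ i ∈ Finset.range m, ((legendreOrtho i).eval x) ^ 2)⁻¹

/-! ### The hypotheses -/

/-- Hypothesis [K1] on a kernel. -/
def HypK1 (k : C(I × I, ℝ)) : Prop :=
  ((∀ y : I, Integrable fun x : I => k (x, y)) ∧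
    BddAbove (Set.range fun y : I => ∫ x : I, |k (x, y)|)) ∧
  ∀ y₀ : I, Tendsto (fun y : I => ∫ x : I, |k (x, y) - k (x, y₀)|) (𝓝 y₀) (𝓝 0)

/-- The partial derivative `∂h/∂v (x, v)`, where for each `x` the variable `v` ranges in `S x`
(one-sided at an end point of the interval `S x`). -/
def partialV (S : I → Set ℝ) (h : I → ℝ → ℝ) : I → ℝ → ℝ :=
  fun x v => derivWithin (h x) (S x) v

/-- `∂h/∂v (x, v)` exists and is jointly continuous for `x ∈ [-1, 1]` and `v ∈ S x`. -/
def HasContPartialV (S : I → Set ℝ) (h : I → ℝ → ℝ) : Prop :=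
  (∀ x, DifferentiableOn ℝ (h x) (S x)) ∧
    ContinuousOn (fun p : I × ℝ => partialV S h p.1 p.2) {p | p.2 ∈ S p.1}

/-- For each `x`, the set of the values `f x` with `f` in the closed ball `B(f₀, δ)` of `C⁰`:
the interval `[f₀ x - δ, f₀ x + δ]`. -/
def tube (f₀ : C0) (δ : ℝ) : I → Set ℝ := fun x => Metric.closedBall (f₀ x) δ

/-- Hypothesis [H2] in the ball `B(f₀, δ)`. -/
def HypH2 (h : C(I × ℝ, ℝ)) (f₀ : C0) (δ : ℝ) : Prop :=
  HasContPartialV (tube f₀ δ) (fun x v => h (x, v))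

/-- Hypothesis [H3] in the ball `B(f₀, δ)`: `∂h/∂v` has itself a continuous partial derivative
`∂²h/∂v²`. -/
def HypH3 (h : C(I × ℝ, ℝ)) (f₀ : C0) (δ : ℝ) : Prop :=
  HasContPartialV (tube f₀ δ) (partialV (tube f₀ δ) (fun x v => h (x, v)))

/-! ### The operators -/

theorem continuous_integralOp (k : C(I × I, ℝ)) (f : C0) :
    Continuous fun y : I => ∫ x : I, k (x, y) * f x :=
  (continuous_parametric_integral_of_continuous (μ := (volume : Measure I))
    (f := fun (y x : I) => k (x, y) * f x) (by fun_prop) isCompact_univ).congr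
    fun y => by rw [Measure.restrict_univ]

theorem integrable_C0 (f : C0) : Integrable (fun x : I => f x) :=
  f.continuous.integrable_of_hasCompactSupport (HasCompactSupport.of_compactSpace _)

/-- The Fredholm operator `(K f)(y) = ∫ k(x, y) f(x) dx`, as a linear map `C⁰ → C⁰`. -/
def integralOp (k : C(I × I, ℝ)) : C0 →ₗ[ℝ] C0 where
  toFun f := ⟨fun y => ∫ x : I, k (x, y) * f x, continuous_integralOp k f⟩
  map_add' f₁ f₂ := by
    ext y
    have h (f : C0) : Integrable (fun x : I => k (x, y) * f x) :=
      integrable_C0 ⟨fun x => k (x, y) * f x, by fun_prop⟩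
    simp [mul_add, integral_add (h f₁) (h f₂)]
  map_smul' c f := by
    ext y
    simp [mul_left_comm, integral_const_mul]

/-- The Nemytskii operator `(H f)(x) = h(x, f(x))`. -/
def nemytskii (h : C(I × ℝ, ℝ)) (f : C0) : C0 := ⟨fun x => h (x, f x), by fun_prop⟩

/-- `𝒢 f = K¹ f + K² H f + g`. -/
def opG (k₁ k₂ : C(I × I, ℝ)) (h : C(I × ℝ, ℝ)) (g : C0) (f : C0) : C0 :=
  integralOp k₁ f + integralOp k₂ (nemytskii h f) + g

/-- The discrete operator `(K_m f)(y) = ∑_k λ_k k(x_k, y) f(x_k)`. -/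
def nystromOp (m : ℕ) (k : C(I × I, ℝ)) (f : C0) : C0 :=
  ⟨fun y => ∑ x ∈ nodes m, christoffel m x * k (x, y) * f x, by fun_prop⟩

/-- `𝒢_m f = K¹_m f + K²_m H f + g`. -/
def opGm (k₁ k₂ : C(I × I, ℝ)) (h : C(I × ℝ, ℝ)) (g : C0) (m : ℕ) (f : C0) : C0 :=
  nystromOp m k₁ f + nystromOp m k₂ (nemytskii h f) + g

/-- The continuous function `x ↦ h_v(x, f(x))`, for `f ∈ B(f₀, δ)`. -/
def hvAlong {h : C(I × ℝ, ℝ)} {f₀ : C0} {δ : ℝ} (hH2 : HypH2 h f₀ δ) (f : C0)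
    (hf : f ∈ Metric.closedBall f₀ δ) : C0 :=
  ⟨fun x => partialV (tube f₀ δ) (fun x v => h (x, v)) x (f x),
    hH2.2.comp_continuous (f := fun x : I => (x, f x)) (by fun_prop)
      fun x => (ContinuousMap.dist_apply_le_dist x).trans hf⟩

/-- The Fréchet derivative `𝒢'(f)` at `f ∈ B(f₀, δ)`:
`[𝒢'(f) φ](y) = ∫ k₁(x, y) φ(x) dx + ∫ k₂(x, y) h_v(x, f(x)) φ(x) dx`. -/
def derivG (k₁ k₂ : C(I × I, ℝ)) {h : C(I × ℝ, ℝ)} {f₀ : C0} {δ : ℝ} (hH2 : HypH2 h f₀ δ)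
    (f : C0) (hf : f ∈ Metric.closedBall f₀ δ) : Module.End ℝ C0 :=
  integralOp k₁ + integralOp k₂ ∘ₗ LinearMap.mulLeft ℝ (hvAlong hH2 f hf)

end Nystrom

end

namespace Nystrom

/-! Put `L = 𝒢'(f*)` and `R = (1 - L)⁻¹`, which exists by the Fredholm alternative, `L` being
compact without eigenvalue 1. Let `A` be the `m`-point discretisation of `L`. In general `A` tends
to `L` only pointwise, so `1 - A` cannot be inverted by perturbation in norm. But `(A - L) A → 0` in
norm (`eventually_norm_nystromOpL_sub_mul_le`), and `B = 1 + R A` satisfies `B (1 - A) = 1 - R (A -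
L) A`, so `B` is an approximate inverse, bounded uniformly in `m`. The fixed points of `𝒢_m` are
those of `f ↦ f - B (f - 𝒢_m f)`, a contraction of a ball whose radius does not depend on `m`
(`existsUnique_fixedPoint_of_approx_inverse`).

The quadrature enters through `tendstoUniformly_quadError`: exactness in degree below `2m` and
nonnegative weights of sum at most 2 give convergence, uniform on compact families of integrands. -/

/-! ### Orthonormality of the Legendre polynomials -/

/-- The linear functional `q ↦ ∫_{-1}^1 q(x) dx` on polynomials. -/
noncomputable def polyIntegral : ℝ[X] →ₗ[ℝ] ℝ where
  toFun q := ∫ x in (-1 : ℝ)..1, q.eval x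
  map_add' p q := by
    simp only [eval_add]
    exact intervalIntegral.integral_add (p.continuous.intervalIntegrable _ _)
      (q.continuous.intervalIntegrable _ _)
  map_smul' c p := by simp

theorem polyIntegral_C (c : ℝ) : polyIntegral (C c) = 2 * c := by
  simp [polyIntegral]; norm_num

theorem polyIntegral_C_mul (c : ℝ) (q : ℝ[X]) :
    polyIntegral (C c * q) = c * polyIntegral q := by
  rw [← smul_eq_C_mul, map_smul, smul_eq_mul]

theorem polyIntegral_derivative (q : ℝ[X]) :
    polyIntegral (derivative q) = q.eval 1 - q.eval (-1) :=
  intervalIntegral.integral_eq_sub_of_hasDerivAt (fun x _ => q.hasDerivAt x)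
    ((derivative q).continuous.intervalIntegrable _ _)

theorem polyIntegral_derivative_mul {p : ℝ[X]} (h₁ : p.eval 1 = 0) (h₂ : p.eval (-1) = 0)
    (q : ℝ[X]) : polyIntegral (derivative p * q) = -polyIntegral (p * derivative q) := by
  have h := polyIntegral_derivative (p * q)
  rw [derivative_mul, map_add] at h
  simp only [eval_mul, h₁, h₂, zero_mul, sub_zero] at h
  linarith

theorem eval_iterate_derivative_X_sq_sub_one_pow {m j : ℕ} (hj : j < m) {a : ℝ}
    (ha : a ^ 2 = 1) : (derivative^[j] ((X ^ 2 - 1 : ℝ[X]) ^ m)).eval a = 0 := by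
  have h := pow_sub_dvd_iterate_derivative_pow (X ^ 2 - 1 : ℝ[X]) m j
  refine eval_eq_zero_of_dvd_of_eval_eq_zero h ?_
  simp [ha, Nat.sub_ne_zero_of_lt hj]

/-- Repeated integration by parts; the boundary terms vanish because derivatives of order below `m`
keep a factor `X ^ 2 - 1`. -/
theorem polyIntegral_iterate_derivative_mul {m j : ℕ} (hj : j ≤ m) (q : ℝ[X]) :
    polyIntegral (derivative^[j] ((X ^ 2 - 1) ^ m) * q) =
      (-1) ^ j * polyIntegral ((X ^ 2 - 1) ^ m * derivative^[j] q) := by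
  induction j generalizing q with
  | zero => simp
  | succ j ih =>
    rw [Function.iterate_succ_apply', polyIntegral_derivative_mul
      (eval_iterate_derivative_X_sq_sub_one_pow hj (by norm_num))
      (eval_iterate_derivative_X_sq_sub_one_pow hj (by norm_num)), ih (by omega),
      ← Function.iterate_succ_apply]
    ring

theorem polyIntegral_X_sq_sub_one_pow (m : ℕ) :
    polyIntegral ((X ^ 2 - 1) ^ m) =
      (-1) ^ m * (2 ^ (2 * m + 1) * (m.factorial : ℝ) ^ 2) / ((2 * m + 1).factorial : ℝ) := by
  induction m with
  | zero => simpa using polyIntegral_C 1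
  | succ m ih =>
    -- Integrating this derivative gives the recursion `(2m+3) I_{m+1} + (2m+2) I_m = 0`.
    have h := polyIntegral_derivative (X * (X ^ 2 - 1) ^ (m + 1))
    have e : derivative (X * (X ^ 2 - 1 : ℝ[X]) ^ (m + 1)) =
        C (2 * m + 3 : ℝ) * (X ^ 2 - 1) ^ (m + 1) + C (2 * m + 2 : ℝ) * (X ^ 2 - 1) ^ m := by
      simp only [derivative_mul, derivative_X, derivative_pow, derivative_sub, derivative_one,
        Nat.add_sub_cancel, C_add, C_mul, C_ofNat, map_natCast, map_one, Nat.cast_add, Nat.cast_one]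
      push_cast
      ring
    rw [e, map_add, polyIntegral_C_mul, polyIntegral_C_mul, ih] at h
    simp only [eval_mul, eval_pow, eval_sub, eval_X, eval_one] at h
    norm_num at h
    have h3 : (2 * m + 3 : ℝ) ≠ 0 := by positivity
    have : polyIntegral ((X ^ 2 - 1) ^ (m + 1)) = -((2 * m + 2 : ℝ) *
        ((-1) ^ m * (2 ^ (2 * m + 1) * (m.factorial : ℝ) ^ 2) / ((2 * m + 1).factorial : ℝ))) /
        (2 * m + 3) := by
      rw [eq_div_iff h3]; linarith
    rw [this, show 2 * (m + 1) + 1 = (2 * m + 1) + 1 + 1 by ring, Nat.factorial_succ (2 * m + 1 + 1),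
      Nat.factorial_succ (2 * m + 1), Nat.factorial_succ m]
    push_cast
    have : ((2 * m + 1).factorial : ℝ) ≠ 0 := by positivity
    field_simp
    ring

theorem natDegree_iterate_derivative_eq {K : Type*} [Field K] [CharZero K] (p : K[X]) (k : ℕ) :
    (derivative^[k] p).natDegree = p.natDegree - k := by
  induction k with
  | zero => rfl
  | succ k ih =>
    rw [Function.iterate_succ_apply', natDegree_derivative, ih, Nat.sub_sub]

theorem monic_X_sq_sub_one_pow (m : ℕ) : ((X ^ 2 - 1 : ℝ[X]) ^ m).Monic :=
  (by monicity! : (X ^ 2 - 1 : ℝ[X]).Monic).pow m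

theorem natDegree_X_sq_sub_one_pow (m : ℕ) : ((X ^ 2 - 1 : ℝ[X]) ^ m).natDegree = 2 * m := by
  rw [natDegree_pow, (by compute_degree! : (X ^ 2 - 1 : ℝ[X]).natDegree = 2), mul_comm]

theorem iterate_derivative_two_mul_X_sq_sub_one_pow (m : ℕ) :
    derivative^[2 * m] ((X ^ 2 - 1 : ℝ[X]) ^ m) = C ((2 * m).factorial : ℝ) := by
  have h : (derivative^[2 * m] ((X ^ 2 - 1 : ℝ[X]) ^ m)).natDegree = 0 := by
    rw [natDegree_iterate_derivative_eq, natDegree_X_sq_sub_one_pow, Nat.sub_self]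
  rw [eq_C_of_natDegree_eq_zero h, coeff_iterate_derivative, zero_add, Nat.descFactorial_self]
  have := (monic_X_sq_sub_one_pow m).coeff_natDegree
  rw [natDegree_X_sq_sub_one_pow] at this
  simp [this]

theorem legendreOrtho_const_pos (m : ℕ) :
    0 < Real.sqrt ((2 * m + 1) / 2) / (2 ^ m * (m.factorial : ℝ)) := by positivity

theorem natDegree_iterate_derivative_X_sq_sub_one_pow (m : ℕ) :
    (derivative^[m] ((X ^ 2 - 1 : ℝ[X]) ^ m)).natDegree = m := by
  rw [natDegree_iterate_derivative_eq, natDegree_X_sq_sub_one_pow]; omega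

theorem natDegree_legendreOrtho (m : ℕ) : (legendreOrtho m).natDegree = m := by
  rw [legendreOrtho, natDegree_C_mul (legendreOrtho_const_pos m).ne',
    natDegree_iterate_derivative_X_sq_sub_one_pow]

theorem iterate_derivative_X_sq_sub_one_pow_ne_zero {m j : ℕ} (hj : j ≤ 2 * m) :
    derivative^[j] ((X ^ 2 - 1 : ℝ[X]) ^ m) ≠ 0 := by
  intro h
  have := iterate_derivative_two_mul_X_sq_sub_one_pow m
  rw [← Nat.sub_add_cancel hj, Function.iterate_add_apply, h, iterate_derivative_zero] at this
  exact (C_ne_zero.mpr (by positivity)) this.symm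

theorem legendreOrtho_ne_zero (m : ℕ) : legendreOrtho m ≠ 0 :=
  mul_ne_zero (C_ne_zero.mpr (legendreOrtho_const_pos m).ne')
    (iterate_derivative_X_sq_sub_one_pow_ne_zero (by omega))

theorem polyIntegral_legendreOrtho_mul {m : ℕ} {q : ℝ[X]} (hq : q.degree < m) :
    polyIntegral (legendreOrtho m * q) = 0 := by
  rw [legendreOrtho, mul_assoc, polyIntegral_C_mul, polyIntegral_iterate_derivative_mul le_rfl,
    iterate_derivative_eq_zero_of_degree_lt hq]
  simp

theorem polyIntegral_legendreOrtho_mul_self (m : ℕ) :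
    polyIntegral (legendreOrtho m * legendreOrtho m) = 1 := by
  set c := Real.sqrt ((2 * m + 1) / 2) / (2 ^ m * (m.factorial : ℝ)) with hc
  have e : legendreOrtho m * legendreOrtho m = C (c * c) *
      (derivative^[m] ((X ^ 2 - 1) ^ m) * derivative^[m] ((X ^ 2 - 1) ^ m)) := by
    rw [legendreOrtho, C_mul]; ring
  rw [e, polyIntegral_C_mul, polyIntegral_iterate_derivative_mul le_rfl,
    ← Function.iterate_add_apply, ← two_mul, iterate_derivative_two_mul_X_sq_sub_one_pow,
    mul_comm _ (C _), polyIntegral_C_mul, polyIntegral_X_sq_sub_one_pow]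
  have hcc : c * c = ((2 * m + 1) / 2) / (2 ^ m * (m.factorial : ℝ)) ^ 2 := by
    rw [← sq, hc, div_pow, Real.sq_sqrt (by positivity)]
  rw [hcc, Nat.factorial_succ]
  push_cast
  have h1 : ((2 * m).factorial : ℝ) ≠ 0 := by positivity
  have h2 : (m.factorial : ℝ) ≠ 0 := by positivity
  have h3 : (2 * m + 1 : ℝ) ≠ 0 := by positivity
  have h4 : ((-1 : ℝ) ^ m) ^ 2 = 1 := by rw [← pow_mul, mul_comm, pow_mul]; simp
  field_simp
  rw [h4]
  ring

theorem polyIntegral_legendreOrtho_mul_legendreOrtho (i j : ℕ) :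
    polyIntegral (legendreOrtho i * legendreOrtho j) = if i = j then 1 else 0 := by
  have hdeg {i j : ℕ} (h : i < j) : (legendreOrtho i).degree < j :=
    degree_le_natDegree.trans_lt (by rw [natDegree_legendreOrtho]; exact_mod_cast h)
  rcases lt_trichotomy i j with h | rfl | h
  · rw [if_neg h.ne, mul_comm]; exact polyIntegral_legendreOrtho_mul (hdeg h)
  · rw [if_pos rfl, polyIntegral_legendreOrtho_mul_self]
  · rw [if_neg h.ne']; exact polyIntegral_legendreOrtho_mul (hdeg h)

/-! ### The zeros of the Legendre polynomials -/

/-- Rolle gives `j + 1` new zeros, distinct from those of the previous derivative; the zeros `±1`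
persist and add two. -/
theorem card_roots_iterate_derivative_X_sq_sub_one_pow {m j : ℕ} (hj : j < m) :
    j + 2 ≤ (derivative^[j] ((X ^ 2 - 1 : ℝ[X]) ^ m)).roots.toFinset.card := by
  have hsub {i : ℕ} (hi : i < m) :
      ({1, -1} : Finset ℝ) ⊆ (derivative^[i] ((X ^ 2 - 1 : ℝ[X]) ^ m)).roots.toFinset := by
    intro a ha
    rw [Multiset.mem_toFinset,
      mem_roots (iterate_derivative_X_sq_sub_one_pow_ne_zero (by omega)), IsRoot.def]
    refine eval_iterate_derivative_X_sq_sub_one_pow hi ?_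
    simp only [Finset.mem_insert, Finset.mem_singleton] at ha
    rcases ha with rfl | rfl <;> norm_num
  have hcard : ({1, -1} : Finset ℝ).card = 2 := Finset.card_pair (by norm_num)
  induction j with
  | zero => simpa [hcard] using Finset.card_le_card (hsub hj)
  | succ j ih =>
    have h := card_roots_toFinset_le_card_roots_derivative_sdiff_roots_succ
      (derivative^[j] ((X ^ 2 - 1 : ℝ[X]) ^ m))
    rw [← Function.iterate_succ_apply' derivative, ← Nat.add_one] at h
    have h' := ih (by omega)
    have hd : Disjoint ((derivative^[j + 1] ((X ^ 2 - 1 : ℝ[X]) ^ m)).roots.toFinset \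
        (derivative^[j] ((X ^ 2 - 1 : ℝ[X]) ^ m)).roots.toFinset) ({1, -1} : Finset ℝ) :=
      (Finset.sdiff_disjoint).mono_right (hsub (by omega))
    have := Finset.card_le_card (Finset.union_subset (Finset.sdiff_subset (s :=
      (derivative^[j + 1] ((X ^ 2 - 1 : ℝ[X]) ^ m)).roots.toFinset) (t :=
      (derivative^[j] ((X ^ 2 - 1 : ℝ[X]) ^ m)).roots.toFinset)) (hsub hj))
    rw [Finset.card_union_of_disjoint hd, hcard] at this
    omega

theorem roots_legendreOrtho (m : ℕ) :
    (legendreOrtho m).roots = (derivative^[m] ((X ^ 2 - 1 : ℝ[X]) ^ m)).roots :=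
  roots_C_mul _ (legendreOrtho_const_pos m).ne'

theorem card_roots_toFinset_legendreOrtho (m : ℕ) :
    (legendreOrtho m).roots.toFinset.card = m := by
  apply le_antisymm
  · calc _ ≤ Multiset.card (legendreOrtho m).roots := Multiset.toFinset_card_le _
      _ ≤ (legendreOrtho m).natDegree := card_roots' _
      _ = m := natDegree_legendreOrtho m
  · rcases m with _ | m
    · simp
    · have h := card_roots_toFinset_le_derivative (derivative^[m] ((X ^ 2 - 1 : ℝ[X]) ^ (m + 1)))
      have h' := card_roots_iterate_derivative_X_sq_sub_one_pow (Nat.lt_add_one m)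
      rw [← Function.iterate_succ_apply' derivative, ← Nat.add_one] at h
      rw [roots_legendreOrtho]
      omega

/-- Gauss-Lucas: differentiation keeps the zeros in the convex hull of the previous ones, hence in
the unit disc. This places the real zeros of `p_m` in `[-1, 1]`. -/
theorem norm_le_one_of_isRoot_iterate_derivative {m j : ℕ} (hj : j < 2 * m) {z : ℂ}
    (hz : (derivative^[j] ((X ^ 2 - 1 : ℂ[X]) ^ m)).IsRoot z) : ‖z‖ ≤ 1 := by
  have hdeg (i : ℕ) : (derivative^[i] ((X ^ 2 - 1 : ℂ[X]) ^ m)).natDegree = 2 * m - i := by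
    rw [natDegree_iterate_derivative_eq, natDegree_pow,
      (by compute_degree! : (X ^ 2 - 1 : ℂ[X]).natDegree = 2), mul_comm]
  induction j generalizing z with
  | zero =>
    have h : z ^ 2 = 1 := by
      have := hz
      simp only [Function.iterate_zero, id, IsRoot.def, eval_pow, eval_sub, eval_X, eval_one] at this
      exact sub_eq_zero.mp (pow_eq_zero_iff (by omega) |>.mp this)
    have := congrArg norm h
    rw [norm_pow, norm_one] at this
    exact (pow_le_one_iff_of_nonneg (norm_nonneg _) two_ne_zero).mp this.le
  | succ j ih =>
    have h0 : 0 < (derivative^[j] ((X ^ 2 - 1 : ℂ[X]) ^ m)).degree :=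
      natDegree_pos_iff_degree_pos.mp (by rw [hdeg]; omega)
    have hne : derivative^[j + 1] ((X ^ 2 - 1 : ℂ[X]) ^ m) ≠ 0 := by
      intro h
      rcases Nat.lt_or_ge (j + 1) (2 * m) with h1 | h1
      · have := hdeg (j + 1)
        rw [h, natDegree_zero] at this
        omega
      · omega
    have hmem := rootSet_derivative_subset_convexHull_rootSet h0 (a := z) (by
      rw [mem_rootSet, ← Function.iterate_succ_apply' derivative]
      exact ⟨hne, by simpa using hz⟩)
    have hsub : (derivative^[j] ((X ^ 2 - 1 : ℂ[X]) ^ m)).rootSet ℂ ⊆ Metric.closedBall 0 1 := by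
      intro w hw
      rw [mem_rootSet] at hw
      simpa using ih (by omega) (z := w) (by simpa using hw.2)
    simpa using convexHull_min hsub (convex_closedBall 0 1) hmem

theorem mem_Icc_of_mem_roots_legendreOrtho {m : ℕ} {x : ℝ} (hx : x ∈ (legendreOrtho m).roots) :
    x ∈ Set.Icc (-1 : ℝ) 1 := by
  rcases Nat.eq_zero_or_pos m with rfl | hm
  · have := card_roots' (legendreOrtho 0)
    rw [natDegree_legendreOrtho, Nat.le_zero, Multiset.card_eq_zero] at this
    simp [this] at hx
  · rw [roots_legendreOrtho, mem_roots (iterate_derivative_X_sq_sub_one_pow_ne_zero (by omega))] at hx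
    have := norm_le_one_of_isRoot_iterate_derivative (j := m) (m := m) (by omega) (z := (x : ℂ)) (by
      have h := hx.map (f := Complex.ofRealHom)
      rw [← iterate_derivative_map] at h
      simpa using h)
    rw [Complex.norm_real, Real.norm_eq_abs] at this
    exact abs_le.mp this

theorem mem_nodes {m : ℕ} {x : I} : x ∈ nodes m ↔ (legendreOrtho m).eval (x : ℝ) = 0 := by
  rw [nodes, Finset.mem_subtype, Multiset.mem_toFinset, mem_roots (legendreOrtho_ne_zero m),
    IsRoot.def]

theorem card_nodes (m : ℕ) : (nodes m).card = m := by
  classical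
  rw [nodes, Finset.card_subtype, Finset.filter_true_of_mem]
  · convert card_roots_toFinset_legendreOrtho m
  · intro x hx
    exact mem_Icc_of_mem_roots_legendreOrtho (Multiset.mem_toFinset.mp hx)

/-! ### Exactness of the Gauss-Legendre rule -/

/-- Divide `q` by `p_m`: the multiple of `p_m` integrates to zero by orthogonality and vanishes at
the nodes, while the remainder equals its Lagrange interpolant. -/
theorem exists_weights_polyIntegral (m : ℕ) :
    ∃ w : I → ℝ, ∀ q : ℝ[X], q.degree < m + m →
      polyIntegral q = ∑ x ∈ nodes m, w x * q.eval (x : ℝ) := by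
  classical
  have hinj : Set.InjOn (fun x : I => (x : ℝ)) (nodes m) := Subtype.val_injective.injOn
  refine ⟨fun x => polyIntegral (Lagrange.basis (nodes m) (fun x : I => (x : ℝ)) x), fun q hq => ?_⟩
  have hP := legendreOrtho_ne_zero m
  have hdegP : (legendreOrtho m).degree = m := by
    rw [degree_eq_natDegree hP, natDegree_legendreOrtho]
  have hmod : (q % legendreOrtho m).degree < m := hdegP ▸ EuclideanDomain.mod_lt q hP
  have hdiv : (q / legendreOrtho m).degree < m := by
    by_cases h : q / legendreOrtho m = 0
    · rw [h, degree_zero]; exact WithBot.bot_lt_coe m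
    · have h' := degree_add_div hP (not_lt.mp fun hlt => h ((Polynomial.div_eq_zero_iff hP).mpr hlt))
      rw [hdegP, degree_eq_natDegree h] at h'
      rw [← h'] at hq
      rw [degree_eq_natDegree h]
      norm_cast at hq ⊢
      omega
  have heval (x : I) (hx : x ∈ nodes m) :
      (q % legendreOrtho m).eval (x : ℝ) = q.eval (x : ℝ) := by
    conv_rhs => rw [← EuclideanDomain.div_add_mod q (legendreOrtho m)]
    rw [eval_add, eval_mul, mem_nodes.mp hx, zero_mul, zero_add]
  conv_lhs => rw [← EuclideanDomain.div_add_mod q (legendreOrtho m), map_add,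
    polyIntegral_legendreOrtho_mul hdiv, zero_add,
    Lagrange.eq_interpolate (f := q % legendreOrtho m) hinj (by rwa [card_nodes]),
    Lagrange.interpolate_apply, map_sum]
  refine Finset.sum_congr rfl fun x hx => ?_
  rw [polyIntegral_C_mul, heval x hx, mul_comm]

/-- Exactness on `p_i p_j` says `A * B = 1` for square matrices. The diagonal of `B * A = 1` then
reads `w(x) ∑ p_i(x)² = 1`, so the weights are the Christoffel numbers. -/
theorem polyIntegral_eq_sum_nodes {m : ℕ} {q : ℝ[X]} (hq : q.degree < m + m) :
    polyIntegral q = ∑ x ∈ nodes m, christoffel m x * q.eval (x : ℝ) := by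
  classical
  obtain ⟨w, hw⟩ := exists_weights_polyIntegral m
  rw [hw q hq]
  let A : Matrix (Fin m) (nodes m) ℝ := fun i x => (legendreOrtho i).eval (x : ℝ) * w x
  let B : Matrix (nodes m) (Fin m) ℝ := fun x j => (legendreOrtho j).eval (x : ℝ)
  have hAB : A * B = 1 := by
    ext i j
    have hdeg : (legendreOrtho i * legendreOrtho j).degree < m + m := by
      rw [degree_mul, degree_eq_natDegree (legendreOrtho_ne_zero _),
        degree_eq_natDegree (legendreOrtho_ne_zero _), natDegree_legendreOrtho,
        natDegree_legendreOrtho]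
      norm_cast
      omega
    have h := hw _ hdeg
    rw [polyIntegral_legendreOrtho_mul_legendreOrtho] at h
    rw [Matrix.mul_apply, Matrix.one_apply]
    simp only [Fin.ext_iff]
    rw [h, ← Finset.sum_coe_sort (nodes m)]
    refine Finset.sum_congr rfl fun x _ => ?_
    simp only [A, B, eval_mul]
    ring
  have hBA := (Matrix.mul_eq_one_comm_of_card_eq _ _ _ (by simp [card_nodes])).mp hAB
  refine Finset.sum_congr rfl fun x hx => ?_
  have h := congrFun (congrFun hBA ⟨x, hx⟩) ⟨x, hx⟩
  rw [Matrix.mul_apply, Matrix.one_apply_eq] at h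
  congr 1
  rw [christoffel, Finset.sum_range]
  refine eq_inv_of_mul_eq_one_left ?_
  refine Eq.trans ?_ h
  rw [Finset.mul_sum]
  refine Finset.sum_congr rfl fun i _ => ?_
  simp only [A, B]
  ring

theorem christoffel_nonneg (m : ℕ) (x : ℝ) : 0 ≤ christoffel m x :=
  inv_nonneg.mpr (Finset.sum_nonneg fun _ _ => sq_nonneg _)

theorem sum_christoffel_le (m : ℕ) : ∑ x ∈ nodes m, christoffel m x ≤ 2 := by
  rcases Nat.eq_zero_or_pos m with rfl | hm
  · have : nodes 0 = ∅ := Finset.card_eq_zero.mp (card_nodes 0)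
    simp [this]
  · have h := polyIntegral_eq_sum_nodes (m := m) (q := C 1)
      (degree_C_le.trans_lt (by norm_cast; omega))
    rw [polyIntegral_C] at h
    simp only [eval_C, mul_one] at h
    exact h.ge

/-! ### Convergence of the Gauss-Legendre rule -/

theorem abs_sum_nodes_le (m : ℕ) {f : I → ℝ} {C : ℝ} (hC : 0 ≤ C) (hf : ∀ x, |f x| ≤ C) :
    |∑ x ∈ nodes m, christoffel m x * f x| ≤ 2 * C := by
  calc |∑ x ∈ nodes m, christoffel m x * f x|
      ≤ ∑ x ∈ nodes m, |christoffel m x * f x| := Finset.abs_sum_le_sum_abs _ _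
    _ ≤ ∑ x ∈ nodes m, christoffel m x * C := by
        refine Finset.sum_le_sum fun x _ => ?_
        rw [abs_mul, abs_of_nonneg (christoffel_nonneg m x)]
        exact mul_le_mul_of_nonneg_left (hf x) (christoffel_nonneg m x)
    _ ≤ 2 * C := by
        rw [← Finset.sum_mul]
        exact mul_le_mul_of_nonneg_right (sum_christoffel_le m) hC

theorem volume_real_univ_I : (volume : Measure I).real Set.univ = 2 := by
  rw [Measure.real, Measure.Subtype.volume_univ measurableSet_Icc.nullMeasurableSet,
    Real.volume_Icc]
  norm_num

theorem abs_integral_le {f : I → ℝ} {C : ℝ} (hf : ∀ x, |f x| ≤ C) :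
    |∫ x : I, f x| ≤ 2 * C := by
  have := norm_integral_le_of_norm_le_const (μ := (volume : Measure I)) (f := f) (C := C)
    (Eventually.of_forall hf)
  rwa [volume_real_univ_I, mul_comm] at this

theorem integral_eval_eq_polyIntegral (q : ℝ[X]) :
    ∫ x : I, q.eval (x : ℝ) = polyIntegral q := by
  have h := integral_subtype_comap (μ := (volume : Measure ℝ)) (measurableSet_Icc (a := (-1 : ℝ))
    (b := 1)) (fun x => q.eval x)
  refine h.trans ?_
  rw [integral_Icc_eq_integral_Ioc, ← intervalIntegral.integral_of_le (by norm_num)]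
  rfl

/-- The error functional of the `m`-point Gauss-Legendre rule. -/
noncomputable def quadError (m : ℕ) : C0 →ₗ[ℝ] ℝ where
  toFun f := ∑ x ∈ nodes m, christoffel m x * f x - ∫ x : I, f x
  map_add' f g := by
    simp only [ContinuousMap.add_apply, mul_add, Finset.sum_add_distrib,
      integral_add (integrable_C0 f) (integrable_C0 g)]
    ring
  map_smul' c f := by
    simp only [ContinuousMap.smul_apply, smul_eq_mul, mul_left_comm _ c, ← Finset.mul_sum,
      integral_const_mul, RingHom.id_apply]
    ring

theorem quadError_apply (m : ℕ) (f : C0) :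
    quadError m f = ∑ x ∈ nodes m, christoffel m x * f x - ∫ x : I, f x := rfl

theorem abs_quadError_le (m : ℕ) (f : C0) : |quadError m f| ≤ 4 * ‖f‖ := by
  have h₁ := abs_sum_nodes_le m (norm_nonneg f) (f := f) f.norm_coe_le_norm
  have h₂ := abs_integral_le (f := f) (C := ‖f‖) f.norm_coe_le_norm
  have := abs_sub (∑ x ∈ nodes m, christoffel m x * f x) (∫ x : I, f x)
  rw [quadError_apply]
  linarith

/-- Weierstrass approximation: the error vanishes on a fixed polynomial once `m` is large, and the
functionals are bounded by 4 uniformly in `m`. -/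
theorem tendsto_quadError (f : C0) : Tendsto (fun m => quadError m f) atTop (𝓝 0) := by
  rw [Metric.tendsto_atTop]
  intro ε hε
  obtain ⟨p, hp⟩ := exists_polynomial_near_continuousMap (-1) 1 f (ε / 8) (by positivity)
  refine ⟨p.natDegree + 1, fun m hm => ?_⟩
  have h0 : quadError m (p.toContinuousMapOn _) = 0 := by
    rw [quadError_apply, sub_eq_zero]
    refine (polyIntegral_eq_sum_nodes (m := m) (q := p) ?_).symm.trans
      (integral_eval_eq_polyIntegral p).symm
    exact degree_le_natDegree.trans_lt (by norm_cast; omega)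
  have h1 := abs_quadError_le m (p.toContinuousMapOn _ - f)
  rw [map_sub, h0, zero_sub, abs_neg] at h1
  rw [Real.dist_eq, sub_zero]
  linarith

theorem tendstoUniformly_quadError {X : Type*} [TopologicalSpace X] [CompactSpace X]
    (F : C(X, C0)) {ε : ℝ} (hε : 0 < ε) : ∀ᶠ m in atTop, ∀ t, |quadError m (F t)| ≤ ε := by
  obtain ⟨s, -, hs⟩ := (isCompact_univ (X := X)).elim_nhds_subcover
    (fun t => F ⁻¹' Metric.ball (F t) (ε / 8))
    (fun t _ => F.continuous.continuousAt.preimage_mem_nhds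
      (Metric.ball_mem_nhds _ (by positivity)))
  have h : ∀ᶠ m in atTop, ∀ t ∈ s, |quadError m (F t)| < ε / 2 := by
    rw [Filter.eventually_all_finset]
    intro t _
    have := (tendsto_quadError (F t)).abs
    rw [abs_zero] at this
    exact this.eventually_lt_const (by positivity)
  filter_upwards [h] with m hm t
  obtain ⟨u, hu, htu⟩ := Set.mem_iUnion₂.mp (hs (Set.mem_univ t))
  have h1 := abs_quadError_le m (F t - F u)
  rw [map_sub] at h1
  have h2 : ‖F t - F u‖ < ε / 8 := by simpa [dist_eq_norm] using htu
  have h3 := abs_sub_abs_le_abs_sub (quadError m (F t)) (quadError m (F u))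
  linarith [hm u hu]

/-! ### The linear operators -/

/-- The function `y ↦ k(·, y)`, with values in `C⁰`. -/
noncomputable def kernelSection (k : C(I × I, ℝ)) : C(I, C0) :=
  (k.comp ContinuousMap.prodSwap).curry

theorem kernelSection_apply (k : C(I × I, ℝ)) (x y : I) : kernelSection k y x = k (x, y) := rfl

theorem norm_kernelSection_le (k : C(I × I, ℝ)) (y : I) : ‖kernelSection k y‖ ≤ ‖k‖ :=
  (ContinuousMap.norm_le _ (norm_nonneg _)).mpr fun x => k.norm_coe_le_norm (x, y)

theorem integralOp_apply (k : C(I × I, ℝ)) (f : C0) (y : I) :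
    integralOp k f y = ∫ x : I, (kernelSection k y * f) x := rfl

theorem nystromOp_apply (m : ℕ) (k : C(I × I, ℝ)) (f : C0) (y : I) :
    nystromOp m k f y = ∑ x ∈ nodes m, christoffel m x * (kernelSection k y * f) x :=
  Finset.sum_congr rfl fun x _ => by rw [ContinuousMap.mul_apply, kernelSection_apply, mul_assoc]

theorem nystromOp_sub_integralOp_apply (m : ℕ) (k : C(I × I, ℝ)) (f : C0) (y : I) :
    (nystromOp m k f - integralOp k f) y = quadError m (kernelSection k y * f) := by
  rw [ContinuousMap.sub_apply, nystromOp_apply, integralOp_apply, quadError_apply]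

theorem abs_mul_apply_le (g f : C0) (x : I) : |(g * f) x| ≤ ‖g‖ * ‖f‖ :=
  ((g * f).norm_coe_le_norm x).trans (norm_mul_le g f)

theorem abs_integralOp_apply_le (k : C(I × I, ℝ)) (f : C0) (y : I) :
    |integralOp k f y| ≤ 2 * (‖k‖ * ‖f‖) := by
  rw [integralOp_apply]
  exact abs_integral_le fun x => (abs_mul_apply_le _ _ x).trans
    (mul_le_mul_of_nonneg_right (norm_kernelSection_le k y) (norm_nonneg f))

theorem abs_nystromOp_apply_le (m : ℕ) (k : C(I × I, ℝ)) (f : C0) (y : I) :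
    |nystromOp m k f y| ≤ 2 * (‖k‖ * ‖f‖) := by
  rw [nystromOp_apply]
  exact abs_sum_nodes_le m (by positivity) fun x => (abs_mul_apply_le _ _ x).trans
    (mul_le_mul_of_nonneg_right (norm_kernelSection_le k y) (norm_nonneg f))

/-- The Fredholm operator as a bounded operator. -/
noncomputable def integralOpL (k : C(I × I, ℝ)) : C0 →L[ℝ] C0 :=
  (integralOp k).mkContinuous (2 * ‖k‖) fun f =>
    (ContinuousMap.norm_le _ (by positivity)).mpr fun y =>
      (abs_integralOp_apply_le k f y).trans_eq (by ring)

/-- The discrete operator `K_m` as a bounded operator. -/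
noncomputable def nystromOpL (m : ℕ) (k : C(I × I, ℝ)) : C0 →L[ℝ] C0 :=
  LinearMap.mkContinuous
    { toFun := nystromOp m k
      map_add' := fun f g => by
        ext y
        simp only [nystromOp_apply, ContinuousMap.add_apply, mul_add, Finset.sum_add_distrib]
      map_smul' := fun c f => by
        ext y
        simp only [nystromOp_apply, ContinuousMap.smul_apply, smul_eq_mul, Finset.mul_sum,
          RingHom.id_apply, mul_smul_comm, mul_left_comm c] }
    (2 * ‖k‖) fun f =>
      (ContinuousMap.norm_le _ (by positivity)).mpr fun y =>
        (abs_nystromOp_apply_le m k f y).trans_eq (by ring)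

theorem integralOpL_apply (k : C(I × I, ℝ)) (f : C0) : integralOpL k f = integralOp k f := rfl

theorem nystromOpL_apply (m : ℕ) (k : C(I × I, ℝ)) (f : C0) :
    nystromOpL m k f = nystromOp m k f := rfl

theorem norm_nystromOpL_le (m : ℕ) (k : C(I × I, ℝ)) : ‖nystromOpL m k‖ ≤ 2 * ‖k‖ :=
  LinearMap.mkContinuous_norm_le _ (by positivity) _

theorem eventually_norm_nystromOp_sub_integralOp_le (k : C(I × I, ℝ)) (f : C0) {ε : ℝ}
    (hε : 0 < ε) : ∀ᶠ m in atTop, ‖nystromOp m k f - integralOp k f‖ ≤ ε := by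
  filter_upwards [tendstoUniformly_quadError
    ⟨fun y => kernelSection k y * f, by fun_prop⟩ hε] with m hm
  refine (ContinuousMap.norm_le _ hε.le).mpr fun y => ?_
  rw [nystromOp_sub_integralOp_apply]
  exact hm y

theorem nystromOp_eq_sum (m : ℕ) (k : C(I × I, ℝ)) (f : C0) :
    nystromOp m k f = ∑ x ∈ nodes m, (christoffel m x * f x) • k.curry x := by
  ext y
  rw [ContinuousMap.sum_apply, nystromOp_apply]
  refine Finset.sum_congr rfl fun x _ => ?_
  simp only [ContinuousMap.mul_apply, kernelSection_apply, ContinuousMap.smul_apply, smul_eq_mul,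
    ContinuousMap.curry_apply]
  ring

/-- The range of `K_m` is spanned by sections `k(x, ·)`, so only quadrature errors of `k(·, y) k(x,
·)` occur. These form a compact family that does not involve `f`. -/
theorem eventually_norm_nystromOpL_sub_mul_le (k : C(I × I, ℝ)) {ε : ℝ} (hε : 0 < ε) :
    ∀ᶠ m in atTop, ‖(nystromOpL m k - integralOpL k) * nystromOpL m k‖ ≤ ε := by
  filter_upwards [tendstoUniformly_quadError
    (⟨fun p : I × I => kernelSection k p.1 * k.curry p.2, by fun_prop⟩ : C(I × I, C0))
    (half_pos hε)] with m hm
  refine ContinuousLinearMap.opNorm_le_bound _ hε.le fun f => ?_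
  refine (ContinuousMap.norm_le _ (by positivity)).mpr fun y => ?_
  have e : ((nystromOpL m k - integralOpL k) * nystromOpL m k) f y =
      ∑ x ∈ nodes m, christoffel m x * (f x * quadError m (kernelSection k y * k.curry x)) := by
    change (nystromOp m k (nystromOp m k f) - integralOp k (nystromOp m k f)) y = _
    rw [nystromOp_sub_integralOp_apply, nystromOp_eq_sum m k f, Finset.mul_sum, map_sum]
    refine Finset.sum_congr rfl fun x _ => ?_
    rw [mul_smul_comm, map_smul, smul_eq_mul, mul_assoc]
  rw [e, Real.norm_eq_abs]
  refine (abs_sum_nodes_le m (C := ‖f‖ * (ε / 2)) (by positivity) fun x => ?_).trans_eq (by ring)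
  rw [abs_mul]
  exact mul_le_mul (f.norm_coe_le_norm x) (hm (y, x)) (abs_nonneg _) (norm_nonneg _)

/-! ### Compactness -/

theorem isCompact_setOf_dist_le {X E : Type*} [TopologicalSpace X] [CompactSpace X]
    [SeminormedAddCommGroup E] (F : C(X, E)) (M : ℝ) :
    IsCompact {f : C(X, ℝ) | (∀ y, |f y| ≤ M) ∧ ∀ y z, |f y - f z| ≤ ‖F y - F z‖} := by
  have hcont (f : X → ℝ) (hf : ∀ y z, |f y - f z| ≤ ‖F y - F z‖) : Continuous f := by
    rw [continuous_iff_continuousAt]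
    intro z
    refine tendsto_iff_norm_sub_tendsto_zero.mpr (squeeze_zero (fun _ => norm_nonneg _)
      (fun y => hf y z) ?_)
    exact tendsto_iff_norm_sub_tendsto_zero.mp F.continuous.continuousAt
  apply ArzelaAscoli.isCompact_of_equicontinuous
  -- The common modulus forces continuity, so the image is a closed subset of a product of compact
  -- intervals.
  · have e : ContinuousMap.toFun '' {f : C(X, ℝ) | (∀ y, |f y| ≤ M) ∧
        ∀ y z, |f y - f z| ≤ ‖F y - F z‖} =
        (Set.univ.pi fun _ => Set.Icc (-M) M) ∩
          {f : X → ℝ | ∀ y z, |f y - f z| ≤ ‖F y - F z‖} := by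
      ext f
      constructor
      · rintro ⟨g, ⟨hg₁, hg₂⟩, rfl⟩
        exact ⟨fun y _ => abs_le.mp (hg₁ y), hg₂⟩
      · rintro ⟨hf₁, hf₂⟩
        exact ⟨⟨f, hcont f hf₂⟩, ⟨fun y => abs_le.mpr (hf₁ y trivial), hf₂⟩, rfl⟩
    rw [e]
    refine (isCompact_univ_pi fun _ => isCompact_Icc).inter_right ?_
    simp only [Set.ofPred_forall]
    exact isClosed_iInter fun y => isClosed_iInter fun z =>
      isClosed_le (by fun_prop) continuous_const
  · refine fun z => Metric.equicontinuousAt_of_continuity_modulus (fun y => ‖F y - F z‖)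
      (tendsto_iff_norm_sub_tendsto_zero.mp F.continuous.continuousAt) _
      (Eventually.of_forall fun y f => ?_)
    rw [dist_comm]
    exact f.2.2 y z

theorem isCompactOperator_of_dist_le (k : C(I × I, ℝ)) {T : C0 →L[ℝ] C0}
    (h₁ : ∀ f y, |T f y| ≤ 2 * (‖k‖ * ‖f‖))
    (h₂ : ∀ f y z, |T f y - T f z| ≤ 2 * (‖kernelSection k y - kernelSection k z‖ * ‖f‖)) :
    IsCompactOperator T := by
  refine (isCompactOperator_iff_image_closedBall_subset_compact (T : C0 →ₗ[ℝ] C0)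
    one_pos).mpr ⟨_, isCompact_setOf_dist_le ((2 : ℝ) • kernelSection k) (2 * ‖k‖), ?_⟩
  rintro _ ⟨f, hf, rfl⟩
  have hf : ‖f‖ ≤ 1 := by simpa using hf
  refine ⟨fun y => (h₁ f y).trans ?_, fun y z => (h₂ f y z).trans ?_⟩
  · nlinarith [norm_nonneg k]
  · rw [ContinuousMap.smul_apply, ContinuousMap.smul_apply, ← smul_sub, norm_smul, Real.norm_two]
    nlinarith [norm_nonneg (kernelSection k y - kernelSection k z)]

theorem isCompactOperator_integralOpL (k : C(I × I, ℝ)) : IsCompactOperator (integralOpL k) := by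
  refine isCompactOperator_of_dist_le k (abs_integralOp_apply_le k) fun f y z => ?_
  rw [integralOpL_apply, integralOp_apply, integralOp_apply,
    ← integral_sub (integrable_C0 _) (integrable_C0 _)]
  refine abs_integral_le fun x => ?_
  rw [← ContinuousMap.sub_apply, ← sub_mul]
  exact abs_mul_apply_le _ _ x

theorem isCompactOperator_nystromOpL (m : ℕ) (k : C(I × I, ℝ)) :
    IsCompactOperator (nystromOpL m k) := by
  refine isCompactOperator_of_dist_le k (abs_nystromOp_apply_le m k) fun f y z => ?_
  rw [nystromOpL_apply, nystromOp_apply, nystromOp_apply, ← Finset.sum_sub_distrib]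
  simp only [← mul_sub, ← ContinuousMap.sub_apply, ← sub_mul]
  exact abs_sum_nodes_le m (by positivity) fun x => abs_mul_apply_le _ _ x

theorem isUnit_one_sub_of_isCompactOperator {X : Type*} [NormedAddCommGroup X] [NormedSpace ℝ X]
    [CompleteSpace X] {T : X →L[ℝ] X} (hT : IsCompactOperator T)
    (h : ¬ Module.End.HasEigenvalue (T : Module.End ℝ X) 1) : IsUnit (1 - T) := by
  have := (hT.hasEigenvalue_or_mem_resolventSet one_ne_zero).resolve_left h
  rwa [spectrum.mem_resolventSet_iff, map_one] at this

/-! ### The nonlinear part -/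

theorem isCompact_tube (f₀ : C0) (δ : ℝ) : IsCompact {p : I × ℝ | p.2 ∈ tube f₀ δ p.1} := by
  have e : {p : I × ℝ | p.2 ∈ tube f₀ δ p.1} =
      (fun p : I × ℝ => (p.1, f₀ p.1 + p.2)) '' (Set.univ ×ˢ Metric.closedBall 0 δ) := by
    ext ⟨x, v⟩
    constructor
    · intro h
      refine ⟨(x, v - f₀ x), ⟨trivial, ?_⟩, by simp⟩
      simpa [tube, Real.dist_eq] using h
    · rintro ⟨⟨x, t⟩, ⟨-, ht⟩, h⟩
      obtain ⟨rfl, rfl⟩ := Prod.mk.inj h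
      simpa [tube, Real.dist_eq] using ht
  rw [e]
  exact (isCompact_univ.prod (isCompact_closedBall 0 δ)).image (by fun_prop)

theorem exists_abs_partialV_sub_le {h : C(I × ℝ, ℝ)} {f₀ : C0} {δ : ℝ} (hδ : 0 < δ)
    (hH2 : HypH2 h f₀ δ) {η : ℝ} (hη : 0 < η) :
    ∃ ε : ℝ, 0 < ε ∧ ε ≤ δ ∧ ∀ x, ∀ v ∈ Metric.closedBall (f₀ x) ε,
      |partialV (tube f₀ δ) (fun x v => h (x, v)) x v -
        partialV (tube f₀ δ) (fun x v => h (x, v)) x (f₀ x)| ≤ η := by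
  have hu := (isCompact_tube f₀ δ).uniformContinuousOn_of_continuous hH2.2
  obtain ⟨ε, hε, H⟩ := Metric.uniformContinuousOn_iff_le.mp hu η hη
  refine ⟨min ε δ, lt_min hε hδ, min_le_right _ _, fun x v hv => ?_⟩
  refine H (x, v) (Metric.closedBall_subset_closedBall (min_le_right _ _) hv) (x, f₀ x)
    (Metric.mem_closedBall_self hδ.le) ?_
  rw [Prod.dist_eq, dist_self, max_eq_right dist_nonneg]
  exact hv.trans (min_le_left _ _)

/-- Mean value inequality for `u ↦ h(x, u) - c u`. -/
theorem abs_sub_sub_mul_le {h : C(I × ℝ, ℝ)} {f₀ : C0} {δ ε η : ℝ} (hH2 : HypH2 h f₀ δ)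
    (hε : ε ≤ δ) {x : I} {c : ℝ} (hc : ∀ v ∈ Metric.closedBall (f₀ x) ε,
      |partialV (tube f₀ δ) (fun x v => h (x, v)) x v - c| ≤ η)
    {v w : ℝ} (hv : v ∈ Metric.closedBall (f₀ x) ε) (hw : w ∈ Metric.closedBall (f₀ x) ε) :
    |h (x, v) - h (x, w) - c * (v - w)| ≤ η * |v - w| := by
  have hsub := Metric.closedBall_subset_closedBall (x := f₀ x) hε
  have hderiv : ∀ u ∈ Metric.closedBall (f₀ x) ε, HasDerivWithinAt (fun u => h (x, u) - c * u)
      (partialV (tube f₀ δ) (fun x v => h (x, v)) x u - c * 1) (Metric.closedBall (f₀ x) ε) u :=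
    fun u hu => (((hH2.1 x) u (hsub hu)).hasDerivWithinAt.mono hsub).sub
      ((hasDerivWithinAt_id u _).const_mul c)
  have := (convex_closedBall (f₀ x) ε).norm_image_sub_le_of_norm_hasDerivWithin_le hderiv
    (fun u hu => by rw [mul_one]; exact hc u hu) hw hv
  simp only [Real.norm_eq_abs] at this
  convert this using 2
  ring

/-- The kernel `k₁(x, y) + k₂(x, y) c(x)`. -/
noncomputable def combinedKernel (k₁ k₂ : C(I × I, ℝ)) (c : C0) : C(I × I, ℝ) :=
  k₁ + k₂ * c.comp ContinuousMap.fst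

theorem kernelSection_combinedKernel_mul (k₁ k₂ : C(I × I, ℝ)) (c f : C0) (y : I) :
    kernelSection (combinedKernel k₁ k₂ c) y * f =
      kernelSection k₁ y * f + kernelSection k₂ y * (c * f) := by
  ext x
  simp only [combinedKernel, ContinuousMap.mul_apply, ContinuousMap.add_apply,
    kernelSection_apply, ContinuousMap.comp_apply, ContinuousMap.fst_apply]
  ring

theorem integralOp_combinedKernel (k₁ k₂ : C(I × I, ℝ)) (c f : C0) :
    integralOp (combinedKernel k₁ k₂ c) f = integralOp k₁ f + integralOp k₂ (c * f) := by
  ext y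
  rw [ContinuousMap.add_apply, integralOp_apply, integralOp_apply, integralOp_apply,
    kernelSection_combinedKernel_mul, ← integral_add (integrable_C0 _) (integrable_C0 _)]
  rfl

theorem nystromOp_combinedKernel (m : ℕ) (k₁ k₂ : C(I × I, ℝ)) (c f : C0) :
    nystromOp m (combinedKernel k₁ k₂ c) f = nystromOp m k₁ f + nystromOp m k₂ (c * f) := by
  ext y
  rw [ContinuousMap.add_apply, nystromOp_apply, nystromOp_apply, nystromOp_apply,
    kernelSection_combinedKernel_mul, ← Finset.sum_add_distrib]
  exact Finset.sum_congr rfl fun x _ => by rw [ContinuousMap.add_apply, mul_add]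

/-- Absorbing `h_v` into the kernel makes the derivative a single Fredholm operator, to which the
linear estimates apply. -/
theorem derivG_eq (k₁ k₂ : C(I × I, ℝ)) {h : C(I × ℝ, ℝ)} {f₀ : C0} {δ : ℝ} (hH2 : HypH2 h f₀ δ)
    (f : C0) (hf : f ∈ Metric.closedBall f₀ δ) :
    derivG k₁ k₂ hH2 f hf = integralOpL (combinedKernel k₁ k₂ (hvAlong hH2 f hf)) :=
  LinearMap.ext fun φ => (integralOp_combinedKernel k₁ k₂ _ φ).symm

/-- The `k₁` terms cancel by linearity; what remains is `K²_m` applied to the linearisation error of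
`h`. -/
theorem norm_opGm_sub_sub_le {k₁ k₂ : C(I × I, ℝ)} {h : C(I × ℝ, ℝ)} (g c : C0) (m : ℕ)
    {η : ℝ} (hη : 0 ≤ η) {f f' : C0}
    (hf : ∀ x, |h (x, f x) - h (x, f' x) - c x * (f x - f' x)| ≤ η * |f x - f' x|) :
    ‖opGm k₁ k₂ h g m f - opGm k₁ k₂ h g m f' - nystromOpL m (combinedKernel k₁ k₂ c) (f - f')‖ ≤
      2 * ‖k₂‖ * η * ‖f - f'‖ := by
  have e : opGm k₁ k₂ h g m f - opGm k₁ k₂ h g m f' -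
      nystromOpL m (combinedKernel k₁ k₂ c) (f - f') =
      nystromOpL m k₂ (nemytskii h f - nemytskii h f' - c * (f - f')) := by
    rw [nystromOpL_apply m (combinedKernel k₁ k₂ c), nystromOp_combinedKernel]
    simp only [← nystromOpL_apply, opGm, map_sub]
    abel
  rw [e]
  have hN : ‖nemytskii h f - nemytskii h f' - c * (f - f')‖ ≤ η * ‖f - f'‖ :=
    (ContinuousMap.norm_le _ (by positivity)).mpr fun x =>
      (hf x).trans (mul_le_mul_of_nonneg_left ((f - f').norm_coe_le_norm x) hη)
  refine (ContinuousLinearMap.le_of_opNorm_le _ (norm_nystromOpL_le m k₂) _).trans ?_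
  rw [mul_assoc (2 * ‖k₂‖)]
  exact mul_le_mul_of_nonneg_left hN (by positivity)

theorem eventually_norm_opG_sub_opGm_le (k₁ k₂ : C(I × I, ℝ)) (h : C(I × ℝ, ℝ)) (g f : C0)
    {ε : ℝ} (hε : 0 < ε) :
    ∀ᶠ m in atTop, ‖opG k₁ k₂ h g f - opGm k₁ k₂ h g m f‖ ≤ ε := by
  filter_upwards [eventually_norm_nystromOp_sub_integralOp_le k₁ f (half_pos hε),
    eventually_norm_nystromOp_sub_integralOp_le k₂ (nemytskii h f) (half_pos hε)] with m h₁ h₂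
  have e : opG k₁ k₂ h g f - opGm k₁ k₂ h g m f = -((nystromOp m k₁ f - integralOp k₁ f) +
      (nystromOp m k₂ (nemytskii h f) - integralOp k₂ (nemytskii h f))) := by
    rw [opG, opGm]
    abel
  rw [e, norm_neg]
  exact (norm_add_le _ _).trans (by linarith)

/-! ### Approximate inverses and the fixed point -/

theorem one_add_mul_mul_one_sub {R : Type*} [Ring R] {r l a : R} (hr : r * (1 - l) = 1) :
    (1 + r * a) * (1 - a) = 1 - r * ((a - l) * a) := by
  have : a = r * (1 - l) * a := by rw [hr, one_mul]
  calc (1 + r * a) * (1 - a) = 1 - a + r * a - r * a * a := by noncomm_ring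
    _ = 1 - r * (1 - l) * a + r * a - r * a * a := by rw [← this]
    _ = _ := by noncomm_ring

/-- The product `(1 + R A)(1 - A)` is invertible by a Neumann series, so `1 - A` is injective, hence
invertible as `A` is compact; cancelling it leaves `1 + R A` invertible. -/
theorem injective_one_add_mul_of_isCompactOperator {X : Type*} [NormedAddCommGroup X]
    [NormedSpace ℝ X] [CompleteSpace X] {R L A : X →L[ℝ] X} (hR : R * (1 - L) = 1)
    (hA : IsCompactOperator A) (h : ‖R * ((A - L) * A)‖ < 1) :
    Function.Injective (1 + R * A : X →L[ℝ] X) := by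
  have hE : IsUnit ((1 + R * A) * (1 - A)) := by
    rw [one_add_mul_mul_one_sub hR]
    exact isUnit_one_sub_of_norm_lt_one h
  have hAu : IsUnit (1 - A) := by
    refine isUnit_one_sub_of_isCompactOperator hA fun hev => ?_
    obtain ⟨x, hx, hx0⟩ := hev.exists_hasEigenvector
    have hAx : A x = x := by simpa using Module.End.mem_eigenspace_iff.mp hx
    obtain ⟨u, hu⟩ := hE
    refine hx0 ?_
    have h1 : ((u : X →L[ℝ] X)) x = 0 := by
      rw [hu, mul_apply_eq_comp]
      simp [hAx]
    calc x = ((↑u⁻¹ : X →L[ℝ] X) * u) x := by rw [Units.inv_mul]; rfl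
      _ = 0 := by rw [mul_apply_eq_comp, h1, map_zero]
  obtain ⟨u, hu⟩ := hAu
  rw [← hu, Units.isUnit_mul_units] at hE
  obtain ⟨v, hv⟩ := hE
  intro x y hxy
  have h1 (z : X) : (↑v⁻¹ : X →L[ℝ] X) ((1 + R * A) z) = z := by
    rw [← hv, ← mul_apply_eq_comp, Units.inv_mul]
    rfl
  rw [← h1 x, ← h1 y, hxy]

theorem existsUnique_fixedPoint_of_approx_inverse {X : Type*} [NormedAddCommGroup X]
    [NormedSpace ℝ X] [CompleteSpace X] {G : X → X} {A B : X →L[ℝ] X} {x₀ : X} {ε η : ℝ}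
    (hε : 0 ≤ ε) (hB : Function.Injective B) (hBA : ‖1 - B * A‖ ≤ 1 / 4)
    (hG : ∀ f ∈ Metric.closedBall x₀ ε, ∀ f' ∈ Metric.closedBall x₀ ε,
      ‖G f - G f' - ((f - f') - A (f - f'))‖ ≤ η * ‖f - f'‖)
    (hη : ‖B‖ * η ≤ 1 / 4) (h₀ : ‖B (x₀ - G x₀)‖ ≤ ε / 2) :
    ∃! f, f ∈ Metric.closedBall x₀ ε ∧ G f = f := by
  let T : X → X := fun f => f - B (f - G f)
  have hT : ∀ f ∈ Metric.closedBall x₀ ε, ∀ f' ∈ Metric.closedBall x₀ ε,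
      ‖T f - T f'‖ ≤ 1 / 2 * ‖f - f'‖ := by
    intro f hf f' hf'
    -- Each of the two terms contributes at most `1/4` to the contraction constant.
    have e : T f - T f' = (1 - B * A) (f - f') + B (G f - G f' - ((f - f') - A (f - f'))) := by
      simp only [T, sub_apply, one_apply_eq_self,
        mul_apply_eq_comp, map_sub]
      abel
    rw [e]
    have h1 := (1 - B * A).le_of_opNorm_le hBA (f - f')
    have h2 := (B.le_opNorm (G f - G f' - ((f - f') - A (f - f')))).trans
      (mul_le_mul_of_nonneg_left (hG f hf f' hf') (norm_nonneg B))
    have h3 := mul_le_mul_of_nonneg_right hη (norm_nonneg (f - f'))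
    refine (norm_add_le _ _).trans ?_
    linarith
  -- Injectivity of `B` is what makes every fixed point of `T` one of `G`.
  have hfix (f : X) : T f = f ↔ G f = f := by
    simp only [T, sub_eq_self]
    rw [map_eq_zero_iff B hB, sub_eq_zero, eq_comm]
  have hmaps : Set.MapsTo T (Metric.closedBall x₀ ε) (Metric.closedBall x₀ ε) := by
    intro f hf
    have h1 := hT f hf x₀ (Metric.mem_closedBall_self hε)
    rw [mem_closedBall_iff_norm] at hf ⊢
    have e : T f - x₀ = (T f - T x₀) + -(B (x₀ - G x₀)) := by simp only [T]; abel
    rw [e]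
    refine (norm_add_le _ _).trans ?_
    rw [norm_neg]
    linarith
  have hcontr : ContractingWith (1 / 2) (hmaps.restrict T _ _) := by
    refine ⟨by norm_num, LipschitzWith.of_dist_le_mul fun f f' => ?_⟩
    rw [Subtype.dist_eq, Subtype.dist_eq, dist_eq_norm, dist_eq_norm]
    simpa using hT f f.2 f' f'.2
  obtain ⟨f, hf, hff, -⟩ := hcontr.exists_fixedPoint' Metric.isClosed_closedBall.isComplete hmaps
    (Metric.mem_closedBall_self hε) (edist_ne_top _ _)
  refine ⟨f, ⟨hf, (hfix f).mp hff⟩, fun f' ⟨hf', hff'⟩ => ?_⟩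
  have h1 := hT f' hf' f hf
  rw [(hfix f').mpr hff', hff] at h1
  exact sub_eq_zero.mp (norm_eq_zero.mp (by linarith [norm_nonneg (f' - f)]))

end Nystrom

theorem mainTheorem2
    -- the kernels, continuous on the square
    (k₁ k₂ : C(Nystrom.I × Nystrom.I, ℝ))
    (hK1 : Nystrom.HypK1 k₁ ∧ Nystrom.HypK1 k₂)
    -- [H1]: `h` is continuous
    (h : C(Nystrom.I × ℝ, ℝ))
    -- [G1]: `g` is continuous
    (g : Nystrom.C0)
    (fstar : Nystrom.C0) (hfix : Nystrom.opG k₁ k₂ h g fstar = fstar)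
    (δ : ℝ) (hδ : 0 < δ)
    (hH2 : Nystrom.HypH2 h fstar δ) (hH3 : Nystrom.HypH3 h fstar δ)
    (heig : ¬ Module.End.HasEigenvalue
      (Nystrom.derivG k₁ k₂ hH2 fstar (Metric.mem_closedBall_self hδ.le)) 1) :
    ∃ ε : ℝ, 0 < ε ∧ ε ≤ δ ∧ ∃ m₀ : ℕ, ∀ m ≥ m₀,
      ∃! f : Nystrom.C0, f ∈ Metric.closedBall fstar ε ∧
        Nystrom.opGm k₁ k₂ h g m f = f := by
  rw [Nystrom.derivG_eq] at heig
  set c := Nystrom.hvAlong hH2 fstar (Metric.mem_closedBall_self hδ.le) with hc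
  set κ := Nystrom.combinedKernel k₁ k₂ c
  obtain ⟨u, hu⟩ := Nystrom.isUnit_one_sub_of_isCompactOperator
    (Nystrom.isCompactOperator_integralOpL κ) heig
  set R : Nystrom.C0 →L[ℝ] Nystrom.C0 := ↑u⁻¹
  have hR : R * (1 - Nystrom.integralOpL κ) = 1 := by rw [← hu]; exact u.inv_mul
  -- `M` bounds all the `B` at once, so `η` and `ε` can be fixed before `m`.
  obtain ⟨M, hM0, hM⟩ : ∃ M : ℝ, 0 < M ∧ ∀ m, ‖1 + R * Nystrom.nystromOpL m κ‖ ≤ M := by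
    refine ⟨‖(1 : Nystrom.C0 →L[ℝ] Nystrom.C0)‖ + ‖R‖ * (2 * ‖κ‖) + 1, by positivity, fun m => ?_⟩
    have h1 := norm_add_le 1 (R * Nystrom.nystromOpL m κ)
    have h2 := (norm_mul_le R (Nystrom.nystromOpL m κ)).trans
      (mul_le_mul_of_nonneg_left (Nystrom.norm_nystromOpL_le m κ) (norm_nonneg R))
    linarith
  -- Chosen so that `M * (2 ‖k₂‖ η) ≤ 1/4`.
  set η : ℝ := 1 / (4 * M * (2 * ‖k₂‖ + 1)) with hη
  have hη0 : 0 < η := by positivity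
  obtain ⟨ε, hε0, hεδ, hε⟩ := Nystrom.exists_abs_partialV_sub_le hδ hH2 hη0
  -- The first tolerance makes `‖R (A - L) A‖ ≤ 1/4`; the second makes the initial defect `‖B (f* -
  -- 𝒢_m f*)‖` at most `ε / 2`.
  have hE : (0 : ℝ) < 1 / (4 * (‖R‖ + 1)) := by positivity
  have hF : 0 < ε / (2 * M) := by positivity
  obtain ⟨m₀, hm₀⟩ := Filter.eventually_atTop.mp
    ((Nystrom.eventually_norm_nystromOpL_sub_mul_le κ hE).and
      (Nystrom.eventually_norm_opG_sub_opGm_le k₁ k₂ h g fstar hF))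
  refine ⟨ε, hε0, hεδ, m₀, fun m hm => ?_⟩
  obtain ⟨h₁, h₂⟩ := hm₀ m hm
  rw [hfix] at h₂
  have h₃ : ‖R * ((Nystrom.nystromOpL m κ - Nystrom.integralOpL κ) * Nystrom.nystromOpL m κ)‖ ≤
      1 / 4 := by
    refine (norm_mul_le R _).trans ((mul_le_mul_of_nonneg_left h₁ (norm_nonneg R)).trans ?_)
    rw [mul_one_div, div_le_div_iff₀ (by positivity) (by norm_num)]
    linarith [norm_nonneg R]
  refine Nystrom.existsUnique_fixedPoint_of_approx_inverse (A := 1 - Nystrom.nystromOpL m κ)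
    (B := 1 + R * Nystrom.nystromOpL m κ) (η := 2 * ‖k₂‖ * η) hε0.le
    (Nystrom.injective_one_add_mul_of_isCompactOperator hR
      (Nystrom.isCompactOperator_nystromOpL m κ) (h₃.trans_lt (by norm_num))) ?_ ?_ ?_ ?_
  · rwa [Nystrom.one_add_mul_mul_one_sub hR, sub_sub_cancel]
  · intro f hf f' hf'
    rw [sub_apply, one_apply_eq_self, sub_sub_cancel]
    have hball {f : Nystrom.C0} (hf : f ∈ Metric.closedBall fstar ε) (x : Nystrom.I) :
        f x ∈ Metric.closedBall (fstar x) ε := (ContinuousMap.dist_apply_le_dist x).trans hf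
    exact Nystrom.norm_opGm_sub_sub_le g c m hη0.le fun x =>
      Nystrom.abs_sub_sub_mul_le hH2 hεδ (hε x) (hball hf x) (hball hf' x)
  · refine (mul_le_mul_of_nonneg_right (hM m) (by positivity)).trans ?_
    rw [hη, mul_one_div, mul_div_assoc', div_le_div_iff₀ (by positivity) (by norm_num)]
    nlinarith [norm_nonneg k₂]
  · refine ((ContinuousLinearMap.le_of_opNorm_le _ (hM m) _).trans
      (mul_le_mul_of_nonneg_left h₂ hM0.le)).trans_eq ?_
    field_simp
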